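/- Let $C\subset\mathbb{R}^3$ be a solid right circular cylinder of radius $r>0$ and height $h>0$, and let $\theta\ge 0$. Let $d_2$ be a diameter of the bottom disk of $C$, and let $d_1$ be the diameter of the top disk obtained from $d_2$ by moving it up by $h$ and rotating it about the axis by the angle $\theta$. Let $h_1,h_2$ be the double helix of rotation angle $\theta$ joining the endpoints of $d_2$ to those of $d_1$: $h_1$ and $h_2$ are the two paths on the side of $C$ traced by the endpoints of $d_2$ when it moves up through the height $h$ at constant speed while turning about the axis at constant speed through the total angle $\theta$ (vertical segments if $\theta=0$). Let $H_C^\theta$ be the compact piece of helicoid (a planar rectangle if $\theta=0$) swept out by the diameter during this screw motion; in coordinates in which $d_2=\{(t,0,0):|t|\le r\}$ and the axis is the $z$-axis, $$H_C^\theta=\{(\rho\cos\theta s,\ \rho\sin\theta s,\ hs): |\rho|\le r,\ 0\le s\le 1\}.$$ Let $\Sigma\subset C$ be a compact immersed minimal surface of arbitrary topological type with $\partial\Sigma=d_1\cup d_2\cup h_1\cup h_2$; that is, $\Sigma$ is the image of a compact surface $M$ with boundary (and possibly corners) under a continuous map which is, in the interior of $M$, a $C^2$ immersion with zero mean curvature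 and which maps $\partial M$ onto $d_1\cup d_2\cup h_1\cup h_2$. If $0\le\theta\le h/r$, then $\Sigma=H_C^\theta$. -/

import Mathlib

open scoped Manifold ContDiff

noncomputable section

/-- Euclidean three-space. -/
abbrev E3 : Type := EuclideanSpace ℝ (Fin 3)

/-- The Euclidean plane, on which surfaces are modelled. -/
abbrev E2 : Type := EuclideanSpace ℝ (Fin 2)

/-! ### Minimal surfaces -/

/-- First partial derivative `X_i` of a parametrization `X` at `u`. -/
def partialDeriv (X : E2 → E3) (u : E2) (i : Fin 2) : E3 :=
  fderiv ℝ X u (EuclideanSpace.single i 1)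

/-- Second partial derivative `X_{ij}` of a parametrization `X` at `u`. -/
def partialDeriv₂ (X : E2 → E3) (u : E2) (i j : Fin 2) : E3 :=
  fderiv ℝ (fun v => partialDeriv X v j) u (EuclideanSpace.single i 1)

/-- Coefficients `g_{ij} = ⟨X_i, X_j⟩` of the first fundamental form. -/
def firstForm (X : E2 → E3) (u : E2) (i j : Fin 2) : ℝ :=
  inner ℝ (partialDeriv X u i) (partialDeriv X u j)

/-- The tangent plane of the parametrized surface `X` at `u`, as a linear subspace. -/
def tangentPlane (X : E2 → E3) (u : E2) : Submodule ℝ E3 :=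
  Submodule.span ℝ (Set.range (partialDeriv X u))

/-- Second fundamental form `b_{ij}` with values in the normal line: the component of `X_{ij}`
orthogonal to the tangent plane. For a unit normal `N` it is `⟨X_{ij}, N⟩ N`. -/
def secondForm (X : E2 → E3) (u : E2) (i j : Fin 2) : E3 :=
  (tangentPlane X u)ᗮ.starProjection (partialDeriv₂ X u i j)

/-- The mean curvature vector
`(1/2) (g₂₂ b₁₁ - 2 g₁₂ b₁₂ + g₁₁ b₂₂) / (g₁₁ g₂₂ - g₁₂²)` of the parametrized surface `X`
(for `X` an immersion at `u`). It does not depend on the orientation. -/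
def meanCurvatureVector (X : E2 → E3) (u : E2) : E3 :=
  (2 * (firstForm X u 0 0 * firstForm X u 1 1 - firstForm X u 0 1 ^ 2))⁻¹ •
    (firstForm X u 1 1 • secondForm X u 0 0
      - (2 * firstForm X u 0 1) • secondForm X u 0 1
      + firstForm X u 0 0 • secondForm X u 1 1)

/-- `f : M → ℝ³` is a minimal surface, where `M` is a surface with boundary (and possibly
corners): `f` is continuous on `M`, and on the interior of `M` it is a `C²` immersion whose mean
curvature vanishes. Nothing beyond continuity is required at the boundary. -/
structure IsMinimalSurface {H : Type*} [TopologicalSpace H] (I : ModelWithCorners ℝ E2 H)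
    {M : Type*} [TopologicalSpace M] [ChartedSpace H M] (f : M → E3) : Prop where
  continuous : Continuous f
  contMDiffAt : ∀ x ∈ I.interior M, ContMDiffAt I 𝓘(ℝ, E3) 2 f x
  immersion : ∀ x ∈ I.interior M, Function.Injective (mfderiv I 𝓘(ℝ, E3) f x)
  meanCurvature_eq_zero : ∀ x ∈ I.interior M,
    meanCurvatureVector (f ∘ (extChartAt I x).symm) (extChartAt I x x) = 0

/-! ### The cylinder and the helicoid

A right circular cylinder is placed in space by the centre `o` of its bottom disk and an
orthonormal basis `b`: the axis has direction `b 2`, and `b 0` is the direction of the diameter of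
the bottom disk. Both orientations of `b`, hence both senses of rotation, are allowed. -/

/-- The point with cylindrical coordinates `(ρ, α, z)` in the frame `(o, b)`. -/
def cylPoint (o : E3) (b : OrthonormalBasis (Fin 3) ℝ E3) (ρ α z : ℝ) : E3 :=
  o + (ρ * Real.cos α) • b 0 + (ρ * Real.sin α) • b 1 + z • b 2

/-- The solid cylinder `C` of radius `r` and height `h`. -/
def solidCylinder (o : E3) (b : OrthonormalBasis (Fin 3) ℝ E3) (r h : ℝ) : Set E3 :=
  {p | inner ℝ (b 0) (p - o) ^ 2 + inner ℝ (b 1) (p - o) ^ 2 ≤ r ^ 2 ∧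
    0 ≤ inner ℝ (b 2) (p - o) ∧ inner ℝ (b 2) (p - o) ≤ h}

/-- The complete helicoid ruled by the lines perpendicular to the axis that turn by the angle `θ`
over the height `h`. For `θ = 0` it is a plane. -/
def helicoid (o : E3) (b : OrthonormalBasis (Fin 3) ℝ E3) (h θ : ℝ) : Set E3 :=
  {p | ∃ ρ s : ℝ, p = cylPoint o b ρ (θ * s) (h * s)}

/-- The compact helicoid `H_C^θ`, the part of the helicoid in the cylinder. -/
def compactHelicoid (o : E3) (b : OrthonormalBasis (Fin 3) ℝ E3) (r h θ : ℝ) : Set E3 :=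
  helicoid o b h θ ∩ solidCylinder o b r h

/-- The diameter of the disk of radius `r` at height `z` in the direction of angle `α`. -/
def diameter (o : E3) (b : OrthonormalBasis (Fin 3) ℝ E3) (r α z : ℝ) : Set E3 :=
  (fun t => cylPoint o b t α z) '' Set.Icc (-r) r

/-- The helix on the side of the cylinder which rises from the bottom to the top at a constant
rate, starts at angle `α` and has rotation angle `θ`. -/
def helix (o : E3) (b : OrthonormalBasis (Fin 3) ℝ E3) (r h α θ : ℝ) : Set E3 :=
  (fun s => cylPoint o b r (α + θ * s) (h * s)) '' Set.Icc 0 1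

/-- The contour `d₁ ∪ d₂ ∪ h₁ ∪ h₂`: the top diameter, the bottom diameter, and the double helix of
rotation angle `θ` (two helices symmetric about the axis) joining their endpoints. -/
def helicalContour (o : E3) (b : OrthonormalBasis (Fin 3) ℝ E3) (r h θ : ℝ) : Set E3 :=
  diameter o b r θ h ∪ diameter o b r 0 0 ∪ helix o b r h 0 θ ∪ helix o b r h Real.pi θ

end

/-! Put `a = θ / h`, so `a r ≤ 1`. In the frame turning with the ruling, let `u` and `v` be the
horizontal coordinates across and along it, so the helicoid is `u = 0`; let `ρ` be the distance to
the axis.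

The surface stays in the helicoid by a maximum principle. For a sign `σ`, suppose `σ u / (1 - λ ρ²)`
has a maximum `c > 0` on the surface. It is attained in the interior, since `u = 0` on the contour,
and there `σ u + c λ ρ²` is also maximal. On a minimal surface its gradient `G` is then normal and
the trace of its Hessian over the tangent plane is nonpositive (`tangential_trace_nonpos`). This
trace times `|G|²` equals `(2 c λ - a² σ u) |G_h|²`, with `G_h` the horizontal part of `G`, and is
positive because `σ u ≤ c` and `a² < 2 λ` (`not_isLocalMax_barrier`). Both signs give `u = 0`.

The surface fills the helicoid by connectedness. In the coordinates `(v, z)` the interior has open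
image, and the contour goes to the boundary of `[-r, r] × [0, h]`. By compactness the image of the
interior is closed in the open rectangle, hence all of it; taking closures gives the rest. -/

/-! ### Second order conditions at a maximum on a minimal surface -/

open Filter Topology in
/-- The necessary second order condition at a local maximum of a function of one variable. -/
theorem IsLocalMax.second_deriv_nonpos {φ φ' : ℝ → ℝ} {t₀ s : ℝ} (hmax : IsLocalMax φ t₀)
    (hφ : ∀ᶠ t in 𝓝 t₀, HasDerivAt φ (φ' t) t) (hφ' : HasDerivAt φ' s t₀) : s ≤ 0 := by
  by_contra! hs
  have hd : deriv φ =ᶠ[𝓝 t₀] φ' := hφ.mono fun t ht => ht.deriv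
  have hdd : deriv (deriv φ) t₀ = s := by rw [hd.deriv_eq, hφ'.deriv]
  -- A positive second derivative would also make the point a local minimum, so `φ` would be locally
  -- constant.
  have hmin : IsLocalMin φ t₀ :=
    isLocalMin_of_deriv_deriv_pos (by rwa [hdd]) hmax.deriv_eq_zero hφ.self_of_nhds.continuousAt
  have hconst : φ =ᶠ[𝓝 t₀] fun _ => φ t₀ := by
    filter_upwards [hmax, hmin] with t h₁ h₂ using le_antisymm h₁ h₂
  have h0 : deriv (deriv φ) t₀ = 0 := by
    rw [hconst.deriv.deriv_eq]
    simp
  linarith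

/-- The trace of a product of a positive definite and a negative semidefinite form on the plane is
nonpositive. -/
theorem trace_mul_nonpos {E F G B₀₀ B₀₁ B₁₁ : ℝ} (hE : 0 < E) (hdet : 0 < E * G - F ^ 2)
    (hB : ∀ s t : ℝ, s ^ 2 * B₀₀ + 2 * (s * t) * B₀₁ + t ^ 2 * B₁₁ ≤ 0) :
    G * B₀₀ - 2 * F * B₀₁ + E * B₁₁ ≤ 0 := by
  have h₁ : B₀₀ ≤ 0 := by simpa using hB 1 0
  -- Completing the square: `E` times the trace is the form at `(-F, E)` plus `(E G - F²) B₀₀`.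
  have h₂ := hB (-F) E
  by_contra! h
  have h₃ := mul_pos hE h
  nlinarith [mul_nonneg hdet.le (neg_nonneg.2 h₁)]

/-- The Gram determinant of an immersion is positive. -/
theorem firstForm_det_pos {X : E2 → E3} {u : E2} (hinj : Function.Injective (fderiv ℝ X u)) :
    0 < firstForm X u 0 0 ∧
      0 < firstForm X u 0 0 * firstForm X u 1 1 - firstForm X u 0 1 ^ 2 := by
  have hP : ∀ s t : ℝ, s • partialDeriv X u 0 + t • partialDeriv X u 1 = 0 → s = 0 ∧ t = 0 := by
    intro s t hst
    have : fderiv ℝ X u (s • EuclideanSpace.single 0 1 + t • EuclideanSpace.single 1 1) = 0 := by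
      simpa [partialDeriv] using hst
    have h0 := hinj (this.trans (map_zero (fderiv ℝ X u)).symm)
    have h₁ := congrArg (fun w : E2 => w 0) h0
    have h₂ := congrArg (fun w : E2 => w 1) h0
    simp at h₁ h₂
    exact ⟨h₁, h₂⟩
  have hE : 0 < firstForm X u 0 0 := by
    refine real_inner_self_pos.2 fun h => ?_
    simpa using hP 1 0 (by simp [h])
  refine ⟨hE, ?_⟩
  -- `w` is `g₀₀` times the part of `X₁` orthogonal to `X₀`.
  set w := (-firstForm X u 0 1) • partialDeriv X u 0 + firstForm X u 0 0 • partialDeriv X u 1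
    with hw
  have hw0 : 0 < inner ℝ w w := by
    refine real_inner_self_pos.2 fun h => ?_
    exact hE.ne' (hP _ _ h).2
  have : inner ℝ w w = firstForm X u 0 0 *
      (firstForm X u 0 0 * firstForm X u 1 1 - firstForm X u 0 1 ^ 2) := by
    rw [hw]
    simp only [inner_add_left, inner_add_right, real_inner_smul_left, real_inner_smul_right]
    rw [real_inner_comm (partialDeriv X u 0) (partialDeriv X u 1)]
    simp only [firstForm]
    ring
  rw [this] at hw0
  exact pos_of_mul_pos_right hw0 hE.le

/-- A minimal immersion satisfies `g₁₁ ⟨X₀₀, n⟩ - 2 g₀₁ ⟨X₀₁, n⟩ + g₀₀ ⟨X₁₁, n⟩ = 0` for every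
normal vector `n`. -/
theorem normal_trace_eq_zero {X : E2 → E3} {u : E2} (hinj : Function.Injective (fderiv ℝ X u))
    (hH : meanCurvatureVector X u = 0) {n : E3} (hn : ∀ i, inner ℝ n (partialDeriv X u i) = 0) :
    firstForm X u 1 1 * inner ℝ n (partialDeriv₂ X u 0 0)
      - 2 * firstForm X u 0 1 * inner ℝ n (partialDeriv₂ X u 0 1)
      + firstForm X u 0 0 * inner ℝ n (partialDeriv₂ X u 1 1) = 0 := by
  have hn' : n ∈ (tangentPlane X u)ᗮ := by
    rw [Submodule.mem_orthogonal']
    intro w hw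
    induction hw using Submodule.span_induction with
    | mem x hx => obtain ⟨i, rfl⟩ := hx; exact hn i
    | zero => simp
    | add x y _ _ hx hy => rw [inner_add_right, hx, hy, add_zero]
    | smul a x _ hx => rw [real_inner_smul_right, hx, mul_zero]
  -- The normal projection is self-adjoint and fixes `n`.
  have hproj : ∀ i j, inner ℝ n (secondForm X u i j) = inner ℝ n (partialDeriv₂ X u i j) := by
    intro i j
    rw [secondForm, ← Submodule.inner_starProjection_left_eq_right,
      Submodule.starProjection_eq_self_iff.2 hn']
  have hdet := (firstForm_det_pos hinj).2
  rw [meanCurvatureVector, smul_eq_zero] at hH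
  have hv := hH.resolve_left (inv_ne_zero (by positivity))
  have := congrArg (fun w => inner ℝ n w) hv
  simpa only [inner_add_right, inner_sub_right, real_inner_smul_right, hproj, inner_zero_right]
    using this

open Filter Topology in
/-- If a function `Φ` with gradient `G` and Hessian `A` has a local maximum on a minimal surface,
then `G` is normal to the surface and the trace of `A` over the tangent plane is nonpositive. -/
theorem tangential_trace_nonpos {X : E2 → E3} {u : E2} (hX : ContDiffAt ℝ 2 X u)
    (hinj : Function.Injective (fderiv ℝ X u)) (hH : meanCurvatureVector X u = 0)
    {Φ : E3 → ℝ} {G : E3 → E3} {A : E3 →L[ℝ] E3} (hΦ : ∀ p, HasGradientAt Φ (G p) p)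
    (hG : HasFDerivAt G A (X u)) (hmax : IsLocalMax (Φ ∘ X) u) :
    (∀ i, inner ℝ (G (X u)) (partialDeriv X u i) = 0) ∧
      firstForm X u 1 1 * inner ℝ (A (partialDeriv X u 0)) (partialDeriv X u 0)
      - firstForm X u 0 1 * (inner ℝ (A (partialDeriv X u 0)) (partialDeriv X u 1)
        + inner ℝ (A (partialDeriv X u 1)) (partialDeriv X u 0))
      + firstForm X u 0 0 * inner ℝ (A (partialDeriv X u 1)) (partialDeriv X u 1) ≤ 0 := by
  have hdX : ∀ᶠ v in 𝓝 u, DifferentiableAt ℝ X v :=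
    (hX.eventually (by simp)).mono fun v hv => hv.differentiableAt (by simp)
  have hdX' : HasFDerivAt (fderiv ℝ X) (fderiv ℝ (fderiv ℝ X) u) u :=
    ((hX.fderiv_right (m := 1) (by norm_num)).differentiableAt (by simp)).hasFDerivAt
  have hline : ∀ (d : E2) (t : ℝ), HasDerivAt (fun t : ℝ => u + t • d) d t := fun d t => by
    simpa using ((hasDerivAt_id t).smul_const d).const_add u
  have hcont : ∀ d : E2, Tendsto (fun t : ℝ => u + t • d) (𝓝 0) (𝓝 u) := fun d => by
    have := (hline d 0).continuousAt.tendsto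
    simpa using this
  have hφ : ∀ d : E2, ∀ᶠ t in 𝓝 (0 : ℝ), HasDerivAt (fun t : ℝ => Φ (X (u + t • d)))
      (inner ℝ (G (X (u + t • d))) (fderiv ℝ X (u + t • d) d)) t := by
    intro d
    filter_upwards [(hcont d).eventually hdX] with t ht
    have h₁ := ht.hasFDerivAt.comp_hasDerivAt t (hline d t)
    have h₂ := (hΦ (X (u + t • d))).hasFDerivAt.comp_hasDerivAt t h₁
    simp only [InnerProductSpace.toDual_apply_apply] at h₂
    exact h₂
  have hmax' : ∀ d : E2, IsLocalMax (fun t : ℝ => Φ (X (u + t • d))) 0 := by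
    intro d
    have := (hcont d).eventually hmax
    filter_upwards [this] with t ht
    simpa using ht
  have hnormal : ∀ d : E2, inner ℝ (G (X u)) (fderiv ℝ X u d) = 0 := by
    intro d
    have := (hmax' d).hasDerivAt_eq_zero (hφ d).self_of_nhds
    simpa using this
  have hn : ∀ i, inner ℝ (G (X u)) (partialDeriv X u i) = 0 := fun i => hnormal _
  refine ⟨hn, ?_⟩
  have hsecond : ∀ d : E2, inner ℝ (A (fderiv ℝ X u d)) (fderiv ℝ X u d)
      + inner ℝ (G (X u)) (fderiv ℝ (fderiv ℝ X) u d d) ≤ 0 := by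
    intro d
    have hu : u + (0 : ℝ) • d = u := by simp
    have h₁ : HasDerivAt (fun t : ℝ => fderiv ℝ X (u + t • d) d)
        (fderiv ℝ (fderiv ℝ X) u d d) 0 := by
      have h := HasFDerivAt.comp_hasDerivAt (x := (0 : ℝ)) (f := fun t : ℝ => u + t • d)
        (l := fderiv ℝ X) (by rw [hu]; exact hdX') (hline d 0)
      simpa using h.clm_apply (hasDerivAt_const (0 : ℝ) d)
    have h₂ : HasDerivAt (fun t : ℝ => X (u + t • d)) (fderiv ℝ X u d) 0 :=
      HasFDerivAt.comp_hasDerivAt (x := (0 : ℝ)) (f := fun t : ℝ => u + t • d)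
        (l := X) (by rw [hu]; exact hdX.self_of_nhds.hasFDerivAt) (hline d 0)
    have h₃ : HasDerivAt (fun t : ℝ => G (X (u + t • d))) (A (fderiv ℝ X u d)) 0 :=
      HasFDerivAt.comp_hasDerivAt (x := (0 : ℝ)) (f := fun t : ℝ => X (u + t • d))
        (l := G) (by simpa only [hu] using hG) h₂
    have h₄ := (hmax' d).second_deriv_nonpos (hφ d) (h₃.inner ℝ h₁)
    simp only [hu] at h₄
    linarith
  have hsymm : ∀ d e : E2, fderiv ℝ (fderiv ℝ X) u d e = fderiv ℝ (fderiv ℝ X) u e d :=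
    fun d e => (hX.isSymmSndFDerivAt (by simp)).eq d e
  have hpd : ∀ i j, partialDeriv₂ X u i j = fderiv ℝ (fderiv ℝ X) u
      (EuclideanSpace.single i 1) (EuclideanSpace.single j 1) := by
    intro i j
    have := hdX'.clm_apply (hasFDerivAt_const (EuclideanSpace.single j (1 : ℝ) : E2) u)
    simp only [partialDeriv₂, partialDeriv]
    rw [this.fderiv]
    simp
  have htrace := normal_trace_eq_zero hinj hH hn
  obtain ⟨hE, hdet⟩ := firstForm_det_pos hinj
  -- The form is the Hessian of `Φ ∘ X`, its mixed entry symmetrised because `A` is not assumed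
  -- symmetric. In the trace the `X_{ij}` terms cancel by minimality.
  have := trace_mul_nonpos (E := firstForm X u 0 0) (F := firstForm X u 0 1)
    (G := firstForm X u 1 1)
    (B₀₀ := inner ℝ (A (partialDeriv X u 0)) (partialDeriv X u 0)
      + inner ℝ (G (X u)) (partialDeriv₂ X u 0 0))
    (B₀₁ := (inner ℝ (A (partialDeriv X u 0)) (partialDeriv X u 1)
        + inner ℝ (A (partialDeriv X u 1)) (partialDeriv X u 0)) / 2
      + inner ℝ (G (X u)) (partialDeriv₂ X u 0 1))
    (B₁₁ := inner ℝ (A (partialDeriv X u 1)) (partialDeriv X u 1)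
      + inner ℝ (G (X u)) (partialDeriv₂ X u 1 1)) hE hdet (by
    intro s t
    have h := hsecond (s • EuclideanSpace.single 0 1 + t • EuclideanSpace.single 1 1)
    simp only [map_add, map_smul, add_apply, smul_apply,
      inner_add_left, inner_add_right, real_inner_smul_left, real_inner_smul_right] at h
    rw [hsymm (EuclideanSpace.single 1 1) (EuclideanSpace.single 0 1)] at h
    simp only [hpd]
    simp only [partialDeriv] at *
    linarith)
  linarith

/-! ### The barrier and its Hessian -/

noncomputable section

/-- The `i`-th coordinate in the frame `(o, b)`. -/
def frameCoord (o : E3) (b : OrthonormalBasis (Fin 3) ℝ E3) (i : Fin 3) (p : E3) : ℝ :=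
  inner ℝ (b i) (p - o)

/-- In the frame rotating about the axis at the rate `a` per unit height, the coordinate of `p`
along the turning diameter. -/
def alongRuling (o : E3) (b : OrthonormalBasis (Fin 3) ℝ E3) (a : ℝ) (p : E3) : ℝ :=
  frameCoord o b 0 p * Real.cos (a * frameCoord o b 2 p)
    + frameCoord o b 1 p * Real.sin (a * frameCoord o b 2 p)

/-- In the frame rotating about the axis at the rate `a` per unit height, the horizontal coordinate
of `p` perpendicular to the turning diameter. It vanishes exactly on the helicoid. -/
def acrossRuling (o : E3) (b : OrthonormalBasis (Fin 3) ℝ E3) (a : ℝ) (p : E3) : ℝ :=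
  frameCoord o b 1 p * Real.cos (a * frameCoord o b 2 p)
    - frameCoord o b 0 p * Real.sin (a * frameCoord o b 2 p)

section Barrier

variable (o : E3) (b : OrthonormalBasis (Fin 3) ℝ E3) (a σ μ : ℝ)

/-- The barrier `σ u + (μ / 2) ρ²`, with `u` the distance across the ruling and `ρ` the distance
from the axis. -/
def barrier (p : E3) : ℝ :=
  σ * acrossRuling o b a p + μ / 2 * (frameCoord o b 0 p ^ 2 + frameCoord o b 1 p ^ 2)

/-- The gradient of `barrier`. -/
def barrierGradient (p : E3) : E3 :=
  (-(σ * Real.sin (a * frameCoord o b 2 p)) + μ * frameCoord o b 0 p) • b 0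
    + (σ * Real.cos (a * frameCoord o b 2 p) + μ * frameCoord o b 1 p) • b 1
    + (-(a * σ * alongRuling o b a p)) • b 2

/-- The Hessian of `barrier`, as an endomorphism. -/
def barrierHessian (p : E3) : E3 →L[ℝ] E3 :=
  (μ • innerSL ℝ (b 0)
      - (a * σ * Real.cos (a * frameCoord o b 2 p)) • innerSL ℝ (b 2)).smulRight (b 0)
    + (μ • innerSL ℝ (b 1)
      - (a * σ * Real.sin (a * frameCoord o b 2 p)) • innerSL ℝ (b 2)).smulRight (b 1)
    + (-(a * σ * Real.cos (a * frameCoord o b 2 p)) • innerSL ℝ (b 0)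
      - (a * σ * Real.sin (a * frameCoord o b 2 p)) • innerSL ℝ (b 1)
      - (a ^ 2 * σ * acrossRuling o b a p) • innerSL ℝ (b 2)).smulRight (b 2)

theorem hasFDerivAt_frameCoord (i : Fin 3) (p : E3) :
    HasFDerivAt (frameCoord o b i) (innerSL ℝ (b i)) p := by
  have := (innerSL ℝ (b i)).hasFDerivAt.comp p ((hasFDerivAt_id p).sub_const o)
  rw [ContinuousLinearMap.comp_id] at this
  exact this

/-- The frame turns at rate `a`, so `∂_z u = -a v` and `∂_z v = a u`. -/
theorem hasFDerivAt_acrossRuling (p : E3) :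
    HasFDerivAt (acrossRuling o b a)
      (Real.cos (a * frameCoord o b 2 p) • innerSL ℝ (b 1)
        - Real.sin (a * frameCoord o b 2 p) • innerSL ℝ (b 0)
        - (a * alongRuling o b a p) • innerSL ℝ (b 2)) p := by
  have hx := hasFDerivAt_frameCoord o b 0 p
  have hy := hasFDerivAt_frameCoord o b 1 p
  have hz := (hasFDerivAt_frameCoord o b 2 p).const_mul a
  refine ((hy.mul hz.cos).sub (hx.mul hz.sin)).congr_fderiv ?_
  ext ξ
  simp [alongRuling]
  ring

theorem hasFDerivAt_alongRuling (p : E3) :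
    HasFDerivAt (alongRuling o b a)
      (Real.cos (a * frameCoord o b 2 p) • innerSL ℝ (b 0)
        + Real.sin (a * frameCoord o b 2 p) • innerSL ℝ (b 1)
        + (a * acrossRuling o b a p) • innerSL ℝ (b 2)) p := by
  have hx := hasFDerivAt_frameCoord o b 0 p
  have hy := hasFDerivAt_frameCoord o b 1 p
  have hz := (hasFDerivAt_frameCoord o b 2 p).const_mul a
  refine ((hx.mul hz.cos).add (hy.mul hz.sin)).congr_fderiv ?_
  ext ξ
  simp [acrossRuling]
  ring

theorem hasGradientAt_barrier (p : E3) :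
    HasGradientAt (barrier o b a σ μ) (barrierGradient o b a σ μ p) p := by
  have hx := hasFDerivAt_frameCoord o b 0 p
  have hy := hasFDerivAt_frameCoord o b 1 p
  have hu := hasFDerivAt_acrossRuling o b a p
  rw [hasGradientAt_iff_hasFDerivAt]
  refine ((hu.const_mul σ).add (((hx.pow 2).add (hy.pow 2)).const_mul (μ / 2))).congr_fderiv ?_
  ext ξ
  simp [barrierGradient]
  ring

theorem hasFDerivAt_barrierGradient (p : E3) :
    HasFDerivAt (barrierGradient o b a σ μ) (barrierHessian o b a σ μ p) p := by
  have hx := hasFDerivAt_frameCoord o b 0 p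
  have hy := hasFDerivAt_frameCoord o b 1 p
  have hz := (hasFDerivAt_frameCoord o b 2 p).const_mul a
  have hv := hasFDerivAt_alongRuling o b a p
  refine (((((hz.sin.const_mul σ).neg.add (hx.const_mul μ)).smul_const (b 0)).add
    (((hz.cos.const_mul σ).add (hy.const_mul μ)).smul_const (b 1))).add
    ((hv.const_mul (a * σ)).neg.smul_const (b 2))).congr_fderiv ?_
  ext1 ξ
  simp only [barrierHessian, add_apply, sub_apply, smul_apply, neg_apply,
    ContinuousLinearMap.smulRight_apply, smul_eq_mul, innerSL_apply_apply]
  congr 1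
  · congr 1
    · congr 1
      ring
    · congr 1
      ring
  · congr 1
    ring

end Barrier

/-- If two vectors of `ℝ³` are orthogonal to `G`, the trace of the symmetric form `Q` over their
span is proportional to the trace of `Q` over the plane orthogonal to `G`. -/
theorem cross_trace_identity (x₀ y₀ z₀ x₁ y₁ z₁ G₀ G₁ G₂ A₀₀ A₁₁ A₂₂ A₀₂ A₁₂ : ℝ)
    (h₀ : G₀ * x₀ + G₁ * y₀ + G₂ * z₀ = 0) (h₁ : G₀ * x₁ + G₁ * y₁ + G₂ * z₁ = 0) :
    let Q : ℝ → ℝ → ℝ → ℝ → ℝ → ℝ → ℝ := fun x y z x' y' z' =>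
      A₀₀ * x * x' + A₁₁ * y * y' + A₂₂ * z * z' + A₀₂ * (x * z' + z * x')
        + A₁₂ * (y * z' + z * y')
    let g := G₀ ^ 2 + G₁ ^ 2 + G₂ ^ 2
    g ^ 2 * ((x₁ ^ 2 + y₁ ^ 2 + z₁ ^ 2) * Q x₀ y₀ z₀ x₀ y₀ z₀
        - 2 * (x₀ * x₁ + y₀ * y₁ + z₀ * z₁) * Q x₀ y₀ z₀ x₁ y₁ z₁
        + (x₀ ^ 2 + y₀ ^ 2 + z₀ ^ 2) * Q x₁ y₁ z₁ x₁ y₁ z₁)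
    = g * ((x₀ ^ 2 + y₀ ^ 2 + z₀ ^ 2) * (x₁ ^ 2 + y₁ ^ 2 + z₁ ^ 2)
        - (x₀ * x₁ + y₀ * y₁ + z₀ * z₁) ^ 2) * (g * (A₀₀ + A₁₁ + A₂₂) - Q G₀ G₁ G₂ G₀ G₁ G₂) := by
  intro Q g
  -- `N` is the cross product of the two vectors. It is parallel to `G`, so `g N = (N · G) G`;
  -- scaling by `g` avoids a division.
  obtain ⟨N₀, hN₀⟩ : ∃ n, n = y₀ * z₁ - z₀ * y₁ := ⟨_, rfl⟩
  obtain ⟨N₁, hN₁⟩ : ∃ n, n = z₀ * x₁ - x₀ * z₁ := ⟨_, rfl⟩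
  obtain ⟨N₂, hN₂⟩ : ∃ n, n = x₀ * y₁ - y₀ * x₁ := ⟨_, rfl⟩
  have e₁ : N₁ * G₂ - N₂ * G₁ = 0 := by
    rw [hN₁, hN₂]; linear_combination x₁ * h₀ - x₀ * h₁
  have e₂ : N₂ * G₀ - N₀ * G₂ = 0 := by
    rw [hN₂, hN₀]; linear_combination y₁ * h₀ - y₀ * h₁
  have e₃ : N₀ * G₁ - N₁ * G₀ = 0 := by
    rw [hN₀, hN₁]; linear_combination z₁ * h₀ - z₀ * h₁
  have f₀ : g * N₀ = (N₀ * G₀ + N₁ * G₁ + N₂ * G₂) * G₀ := by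
    linear_combination G₁ * e₃ - G₂ * e₂
  have f₁ : g * N₁ = (N₀ * G₀ + N₁ * G₁ + N₂ * G₂) * G₁ := by
    linear_combination G₂ * e₁ - G₀ * e₃
  have f₂ : g * N₂ = (N₀ * G₀ + N₁ * G₁ + N₂ * G₂) * G₂ := by
    linear_combination G₀ * e₂ - G₁ * e₁
  -- The trace over a plane is the full trace minus the value on the unit normal, here scaled by
  -- `|N|²`.
  have key : (x₁ ^ 2 + y₁ ^ 2 + z₁ ^ 2) * Q x₀ y₀ z₀ x₀ y₀ z₀
        - 2 * (x₀ * x₁ + y₀ * y₁ + z₀ * z₁) * Q x₀ y₀ z₀ x₁ y₁ z₁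
        + (x₀ ^ 2 + y₀ ^ 2 + z₀ ^ 2) * Q x₁ y₁ z₁ x₁ y₁ z₁
      = (N₀ ^ 2 + N₁ ^ 2 + N₂ ^ 2) * (A₀₀ + A₁₁ + A₂₂) - Q N₀ N₁ N₂ N₀ N₁ N₂ := by
    rw [hN₀, hN₁, hN₂]; simp only [Q]; ring
  have gram : (x₀ ^ 2 + y₀ ^ 2 + z₀ ^ 2) * (x₁ ^ 2 + y₁ ^ 2 + z₁ ^ 2)
        - (x₀ * x₁ + y₀ * y₁ + z₀ * z₁) ^ 2 = N₀ ^ 2 + N₁ ^ 2 + N₂ ^ 2 := by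
    rw [hN₀, hN₁, hN₂]; ring
  have scale : g * (N₀ ^ 2 + N₁ ^ 2 + N₂ ^ 2) = (N₀ * G₀ + N₁ * G₁ + N₂ * G₂) ^ 2 := by
    linear_combination N₀ * f₀ + N₁ * f₁ + N₂ * f₂
  rw [key, gram, scale]
  have expand : g ^ 2 * ((N₀ ^ 2 + N₁ ^ 2 + N₂ ^ 2) * (A₀₀ + A₁₁ + A₂₂) - Q N₀ N₁ N₂ N₀ N₁ N₂)
      = ((g * N₀) ^ 2 + (g * N₁) ^ 2 + (g * N₂) ^ 2) * (A₀₀ + A₁₁ + A₂₂)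
        - Q (g * N₀) (g * N₁) (g * N₂) (g * N₀) (g * N₁) (g * N₂) := by
    simp only [Q]; ring
  rw [expand, f₀, f₁, f₂]
  simp only [Q, g]
  ring

theorem inner_eq_sum_coord (b : OrthonormalBasis (Fin 3) ℝ E3) (ξ η : E3) :
    inner ℝ ξ η = inner ℝ (b 0) ξ * inner ℝ (b 0) η + inner ℝ (b 1) ξ * inner ℝ (b 1) η
      + inner ℝ (b 2) ξ * inner ℝ (b 2) η := by
  rw [← b.sum_inner_mul_inner ξ η, Fin.sum_univ_three]
  simp only [real_inner_comm]

/-- The barrier has no local maximum on a minimal surface where `0 < σ u < μ / a²`. -/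
theorem not_isLocalMax_barrier {X : E2 → E3} {w : E2} (hX : ContDiffAt ℝ 2 X w)
    (hinj : Function.Injective (fderiv ℝ X w)) (hH : meanCurvatureVector X w = 0)
    (o : E3) (b : OrthonormalBasis (Fin 3) ℝ E3) (a σ μ : ℝ) (hσ : σ ^ 2 = 1) (hμ : 0 < μ)
    (hpos : 0 < σ * acrossRuling o b a (X w)) (hlt : a ^ 2 * (σ * acrossRuling o b a (X w)) < μ) :
    ¬ IsLocalMax (barrier o b a σ μ ∘ X) w := by
  intro hmax
  obtain ⟨hn, htr⟩ := tangential_trace_nonpos hX hinj hH (hasGradientAt_barrier o b a σ μ)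
    (hasFDerivAt_barrierGradient o b a σ μ (X w)) hmax
  have hdet := (firstForm_det_pos hinj).2
  have hn₀ := hn 0
  have hn₁ := hn 1
  simp only [barrierGradient, inner_add_left, real_inner_smul_left] at hn₀ hn₁
  simp only [barrierHessian, firstForm, add_apply, sub_apply, smul_apply,
    ContinuousLinearMap.smulRight_apply, smul_eq_mul, innerSL_apply_apply, inner_add_left,
    real_inner_smul_left] at htr hdet
  rw [inner_eq_sum_coord b (partialDeriv X w 0) (partialDeriv X w 0),
    inner_eq_sum_coord b (partialDeriv X w 0) (partialDeriv X w 1),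
    inner_eq_sum_coord b (partialDeriv X w 1) (partialDeriv X w 1)] at htr hdet
  have hid := cross_trace_identity _ _ _ _ _ _ _ _ _ μ μ (-(a ^ 2 * σ * acrossRuling o b a (X w)))
    (-(a * σ * Real.cos (a * frameCoord o b 2 (X w))))
    (-(a * σ * Real.sin (a * frameCoord o b 2 (X w)))) hn₀ hn₁
  simp only [acrossRuling, alongRuling] at *
  have hsc := Real.sin_sq_add_cos_sq (a * frameCoord o b 2 (X w))
  generalize inner ℝ (b 0) (partialDeriv X w 0) = x₀ at *
  generalize inner ℝ (b 1) (partialDeriv X w 0) = y₀ at *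
  generalize inner ℝ (b 2) (partialDeriv X w 0) = z₀ at *
  generalize inner ℝ (b 0) (partialDeriv X w 1) = x₁ at *
  generalize inner ℝ (b 1) (partialDeriv X w 1) = y₁ at *
  generalize inner ℝ (b 2) (partialDeriv X w 1) = z₁ at *
  generalize Real.sin (a * frameCoord o b 2 (X w)) = s at *
  generalize Real.cos (a * frameCoord o b 2 (X w)) = c at *
  generalize frameCoord o b 0 (X w) = x at *
  generalize frameCoord o b 1 (X w) = y at *
  -- The horizontal gradient has squared length `1 + 2 μ σ u + μ² ρ²`.
  have hG : 0 < (-(σ * s) + μ * x) ^ 2 + (σ * c + μ * y) ^ 2 := by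
    have : (-(σ * s) + μ * x) ^ 2 + (σ * c + μ * y) ^ 2
        = 1 + 2 * μ * (σ * (y * c - x * s)) + (μ * x) ^ 2 + (μ * y) ^ 2 := by
      linear_combination σ ^ 2 * hsc + hσ
    rw [this]
    positivity
  -- With `G₂ = -a σ v`, the mixed Hessian terms contribute `2 μ G₂²`, so all terms in `G₂²` cancel.
  have hE : ((-(σ * s) + μ * x) ^ 2 + (σ * c + μ * y) ^ 2 + (-(a * σ * (x * c + y * s))) ^ 2)
        * (μ + μ + -(a ^ 2 * σ * (y * c - x * s)))
      - (μ * (-(σ * s) + μ * x) * (-(σ * s) + μ * x) + μ * (σ * c + μ * y) * (σ * c + μ * y)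
        + -(a ^ 2 * σ * (y * c - x * s)) * (-(a * σ * (x * c + y * s)))
          * (-(a * σ * (x * c + y * s)))
        + -(a * σ * c) * ((-(σ * s) + μ * x) * (-(a * σ * (x * c + y * s)))
          + (-(a * σ * (x * c + y * s))) * (-(σ * s) + μ * x))
        + -(a * σ * s) * ((σ * c + μ * y) * (-(a * σ * (x * c + y * s)))
          + (-(a * σ * (x * c + y * s))) * (σ * c + μ * y)))
      = (μ - a ^ 2 * (σ * (y * c - x * s))) * ((-(σ * s) + μ * x) ^ 2 + (σ * c + μ * y) ^ 2) := by
    ring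
  rw [hE] at hid
  have hpos' : 0 < ((-(σ * s) + μ * x) ^ 2 + (σ * c + μ * y) ^ 2
      + (-(a * σ * (x * c + y * s))) ^ 2) := by positivity
  have hrhs := mul_pos (mul_pos hpos' hdet) (mul_pos (sub_pos.2 hlt) hG)
  have hlhs := mul_nonpos_of_nonneg_of_nonpos (sq_nonneg ((-(σ * s) + μ * x) ^ 2
    + (σ * c + μ * y) ^ 2 + (-(a * σ * (x * c + y * s))) ^ 2)) htr
  refine absurd (lt_of_lt_of_le hrhs ?_) (lt_irrefl 0)
  refine le_of_eq_of_le ?_ hlhs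
  linear_combination -hid

end

/-! ### Interior points in charts -/

section Chart

variable {H : Type*} [TopologicalSpace H] {I : ModelWithCorners ℝ E2 H}
  {M : Type*} [TopologicalSpace M] [ChartedSpace H M]

/-- A minimal surface is `C²` in the preferred chart at an interior point. -/
theorem IsMinimalSurface.contDiffAt_chart {f : M → E3} (hmin : IsMinimalSurface I f) {x : M}
    (hx : x ∈ I.interior M) :
    ContDiffAt ℝ 2 (f ∘ (extChartAt I x).symm) (extChartAt I x x) := by
  have h := (contMDiffAt_iff.1 (hmin.contMDiffAt x hx)).2
  simp only [extChartAt_model_space_eq_id, PartialEquiv.refl_coe, Function.id_comp] at h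
  exact h.contDiffAt (range_mem_nhds_isInteriorPoint hx)

/-- A minimal surface is an immersion in the preferred chart at an interior point. -/
theorem IsMinimalSurface.injective_fderiv_chart {f : M → E3} (hmin : IsMinimalSurface I f) {x : M}
    (hx : x ∈ I.interior M) :
    Function.Injective (fderiv ℝ (f ∘ (extChartAt I x).symm) (extChartAt I x x)) := by
  have h := hmin.immersion x hx
  have hd : MDifferentiableAt I 𝓘(ℝ, E3) f x := (hmin.contMDiffAt x hx).mdifferentiableAt (by simp)
  rw [hd.mfderiv] at h
  have h' : Function.Injective
      (fderivWithin ℝ (f ∘ (extChartAt I x).symm) (Set.range I) (extChartAt I x x)) := h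
  rwa [fderivWithin_of_mem_nhds (range_mem_nhds_isInteriorPoint hx)] at h'

open Topology in
/-- A nonempty manifold with corners has interior points. -/
theorem ModelWithCorners.interior_nonempty [IsManifold I 2 M] [Nonempty M] :
    (I.interior M).Nonempty := by
  obtain ⟨x⟩ := ‹Nonempty M›
  obtain ⟨V, hV, hVt⟩ := mem_nhdsWithin_iff_exists_mem_nhds_inter.1
    (extChartAt_target_mem_nhdsWithin (I := I) x)
  -- The model range lies in the closure of its interior, so interior points of the range occur
  -- arbitrarily near the image of `x`.
  have hcl : extChartAt I x x ∈ closure (interior (Set.range I)) :=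
    I.range_subset_closure_interior (extChartAt_target_subset_range x (mem_extChartAt_target x))
  obtain ⟨y, hyV, hy⟩ := mem_closure_iff_nhds.1 hcl V hV
  have hyt : y ∈ (extChartAt I x).target := hVt ⟨hyV, interior_subset hy⟩
  have hnhds : (extChartAt I x).target ∈ 𝓝 y := by
    have := extChartAt_target_mem_nhdsWithin_of_mem hyt
    rwa [nhdsWithin_eq_nhds.2 (mem_interior_iff_mem_nhds.1 hy)] at this
  refine ⟨(extChartAt I x).symm y, ?_⟩
  have hs : (extChartAt I x).symm y ∈ (chartAt H x).source := by
    rw [← extChartAt_source I x]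
    exact (extChartAt I x).map_target hyt
  refine (I.isInteriorPoint_iff_of_mem_atlas (n := 2) (by simp) (chart_mem_atlas H x) hs).2 ?_
  change extChartAt I x ((extChartAt I x).symm y) ∈ interior (extChartAt I x).target
  rw [(extChartAt I x).right_inv hyt]
  exact mem_interior_iff_mem_nhds.2 hnhds

end Chart

/-! ### Helicoidal coordinates -/

section Coordinates

variable (o : E3) (b : OrthonormalBasis (Fin 3) ℝ E3)

theorem frameCoord_cylPoint (ρ α z : ℝ) :
    frameCoord o b 0 (cylPoint o b ρ α z) = ρ * Real.cos α ∧
      frameCoord o b 1 (cylPoint o b ρ α z) = ρ * Real.sin α ∧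
      frameCoord o b 2 (cylPoint o b ρ α z) = z := by
  have h : cylPoint o b ρ α z - o
      = (ρ * Real.cos α) • b 0 + (ρ * Real.sin α) • b 1 + z • b 2 := by
    rw [cylPoint]; abel
  simp [frameCoord, h, inner_add_right, real_inner_smul_right]

theorem ext_frameCoord {p q : E3} (h : ∀ i, frameCoord o b i p = frameCoord o b i q) : p = q := by
  have : p - o = q - o := b.repr.injective (by
    ext i
    rw [b.repr_apply_apply, b.repr_apply_apply]
    exact h i)
  simpa using this

theorem acrossRuling_cylPoint (a ρ z : ℝ) : acrossRuling o b a (cylPoint o b ρ (a * z) z) = 0 := by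
  obtain ⟨h₀, h₁, h₂⟩ := frameCoord_cylPoint o b ρ (a * z) z
  rw [acrossRuling, h₀, h₁, h₂]
  ring

theorem alongRuling_cylPoint (a ρ z : ℝ) : alongRuling o b a (cylPoint o b ρ (a * z) z) = ρ := by
  obtain ⟨h₀, h₁, h₂⟩ := frameCoord_cylPoint o b ρ (a * z) z
  rw [alongRuling, h₀, h₁, h₂]
  linear_combination ρ * Real.sin_sq_add_cos_sq (a * z)

/-- Undoing the rotation recovers the horizontal position from `(v, u)`; hence `(v, z)` are
injective coordinates on the helicoid. -/
theorem eq_cylPoint_of_acrossRuling_eq_zero {a : ℝ} {p : E3} (hp : acrossRuling o b a p = 0) :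
    p = cylPoint o b (alongRuling o b a p) (a * frameCoord o b 2 p) (frameCoord o b 2 p) := by
  obtain ⟨h₀, h₁, h₂⟩ := frameCoord_cylPoint o b (alongRuling o b a p) (a * frameCoord o b 2 p)
    (frameCoord o b 2 p)
  have hsc := Real.sin_sq_add_cos_sq (a * frameCoord o b 2 p)
  simp only [acrossRuling] at hp
  refine ext_frameCoord o b fun i => ?_
  fin_cases i
  · change frameCoord o b 0 p = _
    refine Eq.trans ?_ h₀.symm
    rw [alongRuling]
    linear_combination -frameCoord o b 0 p * hsc - Real.sin (a * frameCoord o b 2 p) * hp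
  · change frameCoord o b 1 p = _
    refine Eq.trans ?_ h₁.symm
    rw [alongRuling]
    linear_combination -frameCoord o b 1 p * hsc + Real.cos (a * frameCoord o b 2 p) * hp
  · exact h₂.symm

theorem along_sq_add_across_sq (a : ℝ) (p : E3) :
    alongRuling o b a p ^ 2 + acrossRuling o b a p ^ 2
      = frameCoord o b 0 p ^ 2 + frameCoord o b 1 p ^ 2 := by
  rw [alongRuling, acrossRuling]
  linear_combination (frameCoord o b 0 p ^ 2 + frameCoord o b 1 p ^ 2)
    * Real.sin_sq_add_cos_sq (a * frameCoord o b 2 p)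

theorem helicoid_eq {h : ℝ} (hh : h ≠ 0) (θ : ℝ) :
    helicoid o b h θ = {p | acrossRuling o b (θ / h) p = 0} := by
  ext p
  constructor
  · rintro ⟨ρ, s, rfl⟩
    have := acrossRuling_cylPoint o b (θ / h) ρ (h * s)
    rwa [← mul_assoc, div_mul_cancel₀ θ hh] at this
  · intro hp
    refine ⟨alongRuling o b (θ / h) p, frameCoord o b 2 p / h,
      (eq_cylPoint_of_acrossRuling_eq_zero o b hp).trans ?_⟩
    congr 1
    · ring
    · field_simp

/-- In the helicoidal coordinates `(v, z)` the contour lies on the boundary of the rectangle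
`[-r, r] × [0, h]`. -/
theorem exists_of_mem_helicalContour {r h θ : ℝ} (hh : h ≠ 0) {p : E3}
    (hp : p ∈ helicalContour o b r h θ) :
    ∃ ρ z, p = cylPoint o b ρ (θ / h * z) z ∧ (ρ = r ∨ ρ = -r ∨ z = 0 ∨ z = h) := by
  rcases hp with ((⟨t, -, rfl⟩ | ⟨t, -, rfl⟩) | ⟨s, -, rfl⟩) | ⟨s, -, rfl⟩
  · exact ⟨t, h, by rw [div_mul_cancel₀ θ hh], by simp⟩
  · exact ⟨t, 0, by rw [mul_zero], by simp⟩
  · exact ⟨r, h * s, by simp [← mul_assoc, div_mul_cancel₀ θ hh], by simp⟩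
  -- Starting at angle `π` amounts to the signed radius `-r`.
  · refine ⟨-r, h * s, ?_, by simp⟩
    rw [← mul_assoc, div_mul_cancel₀ θ hh]
    simp [cylPoint, add_comm Real.pi]

theorem contDiff_frameCoord (i : Fin 3) : ContDiff ℝ 2 (frameCoord o b i) := by
  exact contDiff_const.inner ℝ (contDiff_id.sub contDiff_const)

theorem contDiff_alongRuling (a : ℝ) : ContDiff ℝ 2 (alongRuling o b a) := by
  have h₀ := contDiff_frameCoord o b 0
  have h₁ := contDiff_frameCoord o b 1
  have h₂ := contDiff_frameCoord o b 2
  unfold alongRuling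
  fun_prop

theorem continuous_acrossRuling (a : ℝ) : Continuous (acrossRuling o b a) := by
  have h₀ := (contDiff_frameCoord o b 0).continuous
  have h₁ := (contDiff_frameCoord o b 1).continuous
  have h₂ := (contDiff_frameCoord o b 2).continuous
  unfold acrossRuling
  fun_prop

end Coordinates

/-! ### Maximum principle and open image -/

section Main

variable {H : Type*} [TopologicalSpace H] {I : ModelWithCorners ℝ E2 H}
  {M : Type*} [TopologicalSpace M] [ChartedSpace H M]
  {o : E3} {b : OrthonormalBasis (Fin 3) ℝ E3} {r a : ℝ} {f : M → E3}

/-- The maximum principle: a compact minimal surface in a cylinder of radius `r ≤ 1 / |a|` whose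
boundary lies in the helicoid of rate `a` does not enter either side of the helicoid. -/
theorem IsMinimalSurface.mul_acrossRuling_nonpos [CompactSpace M] (hmin : IsMinimalSurface I f)
    (hr : 0 < r) (ha : (a * r) ^ 2 ≤ 1)
    (hC : ∀ m, frameCoord o b 0 (f m) ^ 2 + frameCoord o b 1 (f m) ^ 2 ≤ r ^ 2)
    (hbd : ∀ m ∈ I.boundary M, acrossRuling o b a (f m) = 0) {σ : ℝ} (hσ : σ ^ 2 = 1) (m : M) :
    σ * acrossRuling o b a (f m) ≤ 0 := by
  -- Any `λ` with `1/2 < λ r² < 1` works: the upper bound keeps `1 - λ ρ²` positive, the lower one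
  -- gives `a² < 2 λ`.
  set lam : ℝ := 3 / (4 * r ^ 2) with hlam
  have hlampos : 0 < lam := by positivity
  have hlamr : lam * r ^ 2 = 3 / 4 := by rw [hlam]; field_simp
  set R : M → ℝ := fun m => frameCoord o b 0 (f m) ^ 2 + frameCoord o b 1 (f m) ^ 2 with hR
  have hR0 : ∀ m, 0 ≤ R m := fun m => by positivity
  have hP : ∀ m, 0 < 1 - lam * R m := fun m => by nlinarith [hC m]
  have hcR : Continuous R := by
    have h₀ := (contDiff_frameCoord o b 0).continuous
    have h₁ := (contDiff_frameCoord o b 1).continuous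
    have := hmin.continuous
    fun_prop
  have hcW : Continuous fun m => σ * acrossRuling o b a (f m) / (1 - lam * R m) :=
    (continuous_const.mul ((continuous_acrossRuling o b a).comp hmin.continuous)).div
      (continuous_const.sub (continuous_const.mul hcR)) fun m => (hP m).ne'
  obtain ⟨x, -, hx⟩ := isCompact_univ.exists_isMaxOn ⟨m, Set.mem_univ m⟩ hcW.continuousOn
  by_contra! hm
  set c := σ * acrossRuling o b a (f x) / (1 - lam * R x) with hc
  have hle : ∀ y, σ * acrossRuling o b a (f y) / (1 - lam * R y) ≤ c := fun y => hx (Set.mem_univ y)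
  have hcpos : 0 < c := lt_of_lt_of_le (div_pos hm (hP m)) (hle m)
  have hux : σ * acrossRuling o b a (f x) = c * (1 - lam * R x) := by
    rw [hc, div_mul_cancel₀ _ (hP x).ne']
  have hxint : x ∈ I.interior M := by
    rw [← I.compl_boundary]
    intro hxb
    rw [hbd x hxb, mul_zero] at hux
    exact (mul_pos hcpos (hP x)).ne hux
  have hfx : f ((extChartAt I x).symm (extChartAt I x x)) = f x := by rw [extChartAt_to_inv]
  have ha2 : a ^ 2 < 2 * lam := by
    have : a ^ 2 * r ^ 2 < 2 * lam * r ^ 2 := by nlinarith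
    exact lt_of_mul_lt_mul_right this (by positivity)
  -- Maximality of the quotient says `σ u + c λ ρ² ≤ c` on the surface, with equality at `x`; this
  -- is the barrier with `μ = 2 c λ`.
  refine not_isLocalMax_barrier (hmin.contDiffAt_chart hxint) (hmin.injective_fderiv_chart hxint)
    (hmin.meanCurvature_eq_zero x hxint) o b a σ (2 * c * lam) hσ (by positivity) ?_ ?_ ?_
  · rw [Function.comp_apply, hfx, hux]
    exact mul_pos hcpos (hP x)
  · rw [Function.comp_apply, hfx, hux]
    have h₁ : a ^ 2 * (c * (1 - lam * R x)) ≤ a ^ 2 * c := by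
      have := mul_nonneg (mul_nonneg (sq_nonneg a) hcpos.le) (mul_nonneg hlampos.le (hR0 x))
      nlinarith
    have h₂ := mul_lt_mul_of_pos_right ha2 hcpos
    linarith
  · refine Filter.Eventually.of_forall fun y => ?_
    have hb : ∀ n, barrier o b a σ (2 * c * lam) (f n)
        = σ * acrossRuling o b a (f n) + c * lam * R n := fun n => by
      simp only [barrier, hR]; ring
    simp only [Function.comp_apply, hfx, hb, hux]
    have := (div_le_iff₀ (hP _)).1 (hle ((extChartAt I x).symm y))
    linarith

open Topology Filter in
/-- A surface immersed in the helicoid covers a neighbourhood of each of its interior points, in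
the coordinates `(v, z)` of the helicoid. -/
theorem IsMinimalSurface.isOpen_image_interior [IsManifold I 2 M] (hmin : IsMinimalSurface I f)
    (hu : ∀ m, acrossRuling o b a (f m) = 0) :
    IsOpen ((fun m => (alongRuling o b a (f m), frameCoord o b 2 (f m))) '' I.interior M) := by
  rw [isOpen_iff_mem_nhds]
  rintro _ ⟨x, hx, rfl⟩
  set X := f ∘ (extChartAt I x).symm with hXdef
  set w := extChartAt I x x with hw
  have hX := hmin.contDiffAt_chart hx
  have hinj := hmin.injective_fderiv_chart hx
  rw [← hXdef, ← hw] at hX hinj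
  have hXd : HasFDerivAt X (fderiv ℝ X w) w := (hX.differentiableAt (by simp)).hasFDerivAt
  set g : E2 → ℝ × ℝ := fun y => (alongRuling o b a (X y), frameCoord o b 2 (X y)) with hg
  have hgC : ContDiffAt ℝ 2 g w :=
    ((contDiff_alongRuling o b a).contDiffAt.comp w hX).prodMk
      ((contDiff_frameCoord o b 2).contDiffAt.comp w hX)
  have hgs := hgC.hasStrictFDerivAt (by simp)
  have hgd : fderiv ℝ g w = _ := (((hasFDerivAt_alongRuling o b a (X w)).comp w hXd).prodMk
    ((hasFDerivAt_frameCoord o b 2 (X w)).comp w hXd)).fderiv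
  have hacross : ∀ d, Real.cos (a * frameCoord o b 2 (X w)) * inner ℝ (b 1) (fderiv ℝ X w d)
      - Real.sin (a * frameCoord o b 2 (X w)) * inner ℝ (b 0) (fderiv ℝ X w d)
      - a * alongRuling o b a (X w) * inner ℝ (b 2) (fderiv ℝ X w d) = 0 := by
    intro d
    have h₁ := (hasFDerivAt_acrossRuling o b a (X w)).comp w hXd
    have h₂ : acrossRuling o b a ∘ X = fun _ => 0 := funext fun y => hu _
    rw [h₂] at h₁
    have h₃ := congrArg (fun L : E2 →L[ℝ] ℝ => L d) (h₁.unique (hasFDerivAt_const (0 : ℝ) w))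
    simpa using h₃
  -- A vector killed by `dv` and `dz` is also killed by `du`, as `u ∘ X` vanishes; these three
  -- differentials determine `dX`.
  have hginj : Function.Injective (fderiv ℝ g w) := by
    refine (injective_iff_map_eq_zero _).2 fun d hd => ?_
    rw [hgd] at hd
    have h₁ := congrArg Prod.fst hd
    have h₂ := congrArg Prod.snd hd
    have h₃ := hacross d
    simp at h₁ h₂
    rw [h₂] at h₁ h₃
    have hsc := Real.sin_sq_add_cos_sq (a * frameCoord o b 2 (X w))
    have hzero : fderiv ℝ X w d = 0 := by
      refine b.repr.injective ?_
      ext i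
      rw [b.repr_apply_apply, b.repr_apply_apply, inner_zero_right]
      fin_cases i
      · change inner ℝ (b 0) _ = 0
        linear_combination (-inner ℝ (b 0) (fderiv ℝ X w d)) * hsc
          + Real.cos (a * frameCoord o b 2 (X w)) * h₁
          - Real.sin (a * frameCoord o b 2 (X w)) * h₃
      · change inner ℝ (b 1) _ = 0
        linear_combination (-inner ℝ (b 1) (fderiv ℝ X w d)) * hsc
          + Real.sin (a * frameCoord o b 2 (X w)) * h₁
          + Real.cos (a * frameCoord o b 2 (X w)) * h₃
      · exact h₂
    exact hinj (hzero.trans (map_zero _).symm)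
  have hsurj : (fderiv ℝ g w).range = ⊤ := by
    refine LinearMap.range_eq_top.2 ?_
    refine (LinearMap.injective_iff_surjective_of_finrank_eq_finrank
      (f := (fderiv ℝ g w : E2 →ₗ[ℝ] ℝ × ℝ)) ?_).1 hginj
    simp
  have hmap := hgs.map_nhds_eq_of_surj hsurj
  have hgw : g w = (alongRuling o b a (f x), frameCoord o b 2 (f x)) := by
    simp only [hg, hXdef, hw, Function.comp_apply, extChartAt_to_inv]
  change _ ∈ 𝓝 (alongRuling o b a (f x), frameCoord o b 2 (f x))
  rw [← hgw, ← hmap, mem_map]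
  have hmem : (extChartAt I x).symm ⁻¹' I.interior M ∈ 𝓝 w := by
    refine (continuousAt_extChartAt_symm x).preimage_mem_nhds ?_
    rw [extChartAt_to_inv]
    exact (I.isOpen_interior (n := 2) (by simp)).mem_nhds hx
  filter_upwards [hmem] with y hy
  exact ⟨_, hy, rfl⟩

end Main

/-! ### The surface is the whole compact helicoid -/

theorem theorem2p2
    {H : Type*} [TopologicalSpace H] (I : ModelWithCorners ℝ E2 H)
    {M : Type*} [TopologicalSpace M] [T2Space M] [CompactSpace M] [ChartedSpace H M]
    [IsManifold I 2 M]
    (o : E3) (b : OrthonormalBasis (Fin 3) ℝ E3) (r h θ : ℝ) (hr : 0 < r) (hh : 0 < h)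
    (f : M → E3) (hmin : IsMinimalSurface I f)
    (hC : Set.range f ⊆ solidCylinder o b r h)
    (hspan : f '' I.boundary M = helicalContour o b r h θ)
    (hθ₀ : 0 ≤ θ) (hθ : θ ≤ h / r) :
    Set.range f = compactHelicoid o b r h θ := by
  set a := θ / h with ha
  have ha1 : (a * r) ^ 2 ≤ 1 := by
    have h₀ : 0 ≤ a * r := by positivity
    have h₁ : a * r ≤ 1 := by
      rw [ha, div_mul_eq_mul_div, div_le_one hh]
      exact (le_div_iff₀ hr).1 hθ
    exact pow_le_one₀ h₀ h₁
  have hcyl : ∀ m, frameCoord o b 0 (f m) ^ 2 + frameCoord o b 1 (f m) ^ 2 ≤ r ^ 2 ∧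
      0 ≤ frameCoord o b 2 (f m) ∧ frameCoord o b 2 (f m) ≤ h := fun m => hC ⟨m, rfl⟩
  have hcont : ∀ m ∈ I.boundary M, ∃ ρ z, f m = cylPoint o b ρ (a * z) z ∧
      (ρ = r ∨ ρ = -r ∨ z = 0 ∨ z = h) := fun m hm =>
    exists_of_mem_helicalContour o b hh.ne' (hspan ▸ Set.mem_image_of_mem f hm)
  have hbd : ∀ m ∈ I.boundary M, acrossRuling o b a (f m) = 0 := by
    intro m hm
    obtain ⟨ρ, z, hp, -⟩ := hcont m hm
    rw [hp, acrossRuling_cylPoint]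
  have hu : ∀ m, acrossRuling o b a (f m) = 0 := by
    intro m
    have h₁ := hmin.mul_acrossRuling_nonpos hr ha1 (fun m => (hcyl m).1) hbd
      (σ := 1) (by norm_num) m
    have h₂ := hmin.mul_acrossRuling_nonpos hr ha1 (fun m => (hcyl m).1) hbd
      (σ := -1) (by norm_num) m
    linarith
  refine Set.Subset.antisymm ?_ ?_
  · rintro _ ⟨m, rfl⟩
    refine ⟨?_, hC ⟨m, rfl⟩⟩
    rw [helicoid_eq o b hh.ne']
    exact hu m
  set g : M → ℝ × ℝ := fun m => (alongRuling o b a (f m), frameCoord o b 2 (f m)) with hg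
  have hgcont : Continuous g :=
    ((contDiff_alongRuling o b a).continuous.comp hmin.continuous).prodMk
      ((contDiff_frameCoord o b 2).continuous.comp hmin.continuous)
  have hclosed : IsClosed (Set.range g) := (isCompact_range hgcont).isClosed
  have hopen : IsOpen (g '' I.interior M) := hmin.isOpen_image_interior hu
  have hbound : ∀ p, frameCoord o b 0 p ^ 2 + frameCoord o b 1 p ^ 2 ≤ r ^ 2 →
      alongRuling o b a p ∈ Set.Icc (-r) r := by
    intro p hp
    refine abs_le.1 (abs_le_of_sq_le_sq ?_ hr.le)
    linarith [along_sq_add_across_sq o b a p, sq_nonneg (acrossRuling o b a p)]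
  have hne : Nonempty M := by
    have : (helicalContour o b r h θ).Nonempty :=
      ⟨_, Or.inl (Or.inl (Or.inr ⟨0, ⟨by linarith, hr.le⟩, rfl⟩))⟩
    rw [← hspan] at this
    obtain ⟨_, m, -, -⟩ := this
    exact ⟨m⟩
  have hQ : g '' I.interior M ⊆ Set.Ioo (-r) r ×ˢ Set.Ioo 0 h := by
    have h₁ : g '' I.interior M ⊆ Set.Icc (-r) r ×ˢ Set.Icc 0 h := by
      rintro _ ⟨m, -, rfl⟩
      exact ⟨hbound _ (hcyl m).1, (hcyl m).2⟩
    -- An open subset of the closed rectangle lies in the open one.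
    have := interior_maximal h₁ hopen
    rwa [interior_prod_eq, interior_Icc, interior_Icc] at this
  have hsub : Set.Ioo (-r) r ×ˢ Set.Ioo 0 h ⊆ g '' I.interior M := by
    have hconn : IsPreconnected (Set.Ioo (-r) r ×ˢ Set.Ioo 0 h) :=
      isPreconnected_Ioo.prod isPreconnected_Ioo
    refine hconn.subset_of_closure_inter_subset hopen ?_ ?_
    · obtain ⟨m, hm⟩ := ModelWithCorners.interior_nonempty (I := I) (M := M)
      exact ⟨g m, hQ ⟨m, hm, rfl⟩, m, hm, rfl⟩
    · rintro q ⟨hq, hq₁, hq₂⟩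
      -- A limit of image points is attained by compactness. If it lies in the open rectangle it
      -- cannot come from a boundary point of `M`, whose image is on an edge.
      obtain ⟨m, rfl⟩ := closure_minimal (Set.image_subset_range g _) hclosed hq
      refine ⟨m, ?_, rfl⟩
      rw [← I.compl_boundary]
      intro hm
      obtain ⟨ρ, z, hp, hρz⟩ := hcont m hm
      have hv : (g m).1 = ρ := by simp only [hg, hp, alongRuling_cylPoint]
      have hz : (g m).2 = z := by simp only [hg, hp, (frameCoord_cylPoint o b ρ (a * z) z).2.2]
      rw [hv] at hq₁
      rw [hz] at hq₂
      rcases hρz with rfl | rfl | rfl | rfl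
      · exact lt_irrefl _ hq₁.2
      · exact lt_irrefl _ hq₁.1
      · exact lt_irrefl _ hq₂.1
      · exact lt_irrefl _ hq₂.2
  have hfull : Set.Icc (-r) r ×ˢ Set.Icc 0 h ⊆ Set.range g := by
    have := closure_minimal (hsub.trans (Set.image_subset_range g _)) hclosed
    rwa [closure_prod_eq, closure_Ioo (by linarith), closure_Ioo hh.ne] at this
  rintro p ⟨hpH, hpC⟩
  rw [helicoid_eq o b hh.ne'] at hpH
  obtain ⟨m, hm⟩ := hfull
    (show (alongRuling o b a p, frameCoord o b 2 p) ∈ _ from ⟨hbound p hpC.1, hpC.2⟩)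
  refine ⟨m, ?_⟩
  rw [eq_cylPoint_of_acrossRuling_eq_zero o b hpH, eq_cylPoint_of_acrossRuling_eq_zero o b (hu m)]
  simp only [hg, Prod.mk.injEq] at hm
  rw [hm.1, hm.2]
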